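/- **Theorem 1.** Let $\mathcal H$ be a separable real Hilbert space of infinite dimension (for instance $L^2[0,1]$), write $x\otimes y$ for the operator $\zeta\mapsto\langle x,\zeta\rangle y$, and let $\|\cdot\|_{op}$, $\|\cdot\|_{HS}$ be the operator and Hilbert–Schmidt norms. Let $(x_t),(y_t),(z_t),(u_t)$, $t\ge 1$, be sequences of $\mathcal H$-valued random variables and $\mathcal A$ a bounded linear operator on $\mathcal H$. For sequences $a,b$ among them put $\mathcal C_{ab}=\mathbb E[a_t\otimes b_t]$ and $\widehat{\mathcal C}_{ab}=T^{-1}\sum_{t=1}^T a_t\otimes b_t$, and let $\mathfrak F_t=\sigma(\{z_s\}_{1\le s\le t+1},\{u_s\}_{1\le s\le t})$. Assume: (a) $y_t=\mathcal A x_t+u_t$ almost surely for all $t\ge1$, where $x_t,z_t,u_t$ have mean zero, $\mathbb E\|u_t\|^2<\infty$ and $\mathbb E[x_t\otimes u_t]\ne0$; (b) $(x_t,z_t)_{t\ge1}$ is strictly stationary and geometrically strongly mixing, $\mathbb E\|x_t\|^2<\infty$, $\mathbb E\|z_t\|^2<\infty$; (c) $\mathbb E[u_t\mid\mathfrak F_{t-1}]=0$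 for all $t\ge1$; (d) $\mathbb E[u_t\otimes u_t\mid\mathfrak F_{t-1}]=\mathcal C_{uu}$ for all $t\ge1$, and for some $\delta>0$, $\sup_{1\le t\le T}\mathbb E[\|u_t\|^{2+\delta}\mid\mathfrak F_{t-1}]<\infty$ almost surely for every $T$; (e) $\ker \mathcal C_{xz}^*\mathcal C_{xz}=\{0\}$ and $\|\mathcal A\|_{HS}<\infty$; (f) the eigenvalues $\lambda_1^2\ge\lambda_2^2\ge\cdots$ of $\mathcal C_{xz}^*\mathcal C_{xz}$, repeated according to multiplicity, satisfy $\lambda_1^2>\lambda_2^2>\cdots>0$; (g) $\|\widehat{\mathcal C}_{xz}-\mathcal C_{xz}\|_{HS}$, $\|\widehat{\mathcal C}_{zz}-\mathcal C_{zz}\|_{HS}$ and $\|\widehat{\mathcal C}_{uz}-\mathcal C_{uz}\|_{HS}$ are $O_p(T^{-1/2})$; (h) $\|\widehat{\mathcal C}_{uu}-\mathcal C_{uu}\|_{HS}=o_p(1)$. For each $T$ let $\widehat{\mathcal C}_{xz}^*\widehat{\mathcal C}_{xz}=\sum_{j\ge1}\hat\lambda_j^2\,\hat f_j\otimes\hat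 f_j$ be any spectral decomposition with $(\hat f_j)$ orthonormal and $\hat\lambda_1^2\ge\hat\lambda_2^2\ge\cdots\ge0$. For a threshold $\alpha=\alpha_T>0$ put $K=\#\{j:\hat\lambda_j^2>\alpha\}$, $\widehat\Pi_K=\sum_{j\le K}\hat f_j\otimes\hat f_j$, $(\widehat{\mathcal C}_{xz}^*\widehat{\mathcal C}_{xz})_K^{-1}=\sum_{j\le K}\hat\lambda_j^{-2}\hat f_j\otimes\hat f_j$, and define the functional IV estimator (FIVE) $$\widehat{\mathcal A}=\widehat{\mathcal C}_{yz}^*\,\widehat{\mathcal C}_{xz}\,(\widehat{\mathcal C}_{xz}^*\widehat{\mathcal C}_{xz})_K^{-1}.$$ Let $\tau(\alpha)=\sum_{j=1}^K\tau_j$ with $\tau_j=2\sqrt2\max\{(\lambda_{j-1}^2-\lambda_j^2)^{-1},(\lambda_j^2-\lambda_{j+1}^2)^{-1}\}$ for $j\ge2$ and $\tau_1=2\sqrt2(\lambda_1^2-\lambda_2^2)^{-1}$. If, as $T\to\infty$, $\alpha_T\to0$, $T^{-1}\alpha_T^{-1}\to0$ and $T^{-1/2}\tau(\alpha_T)\to0$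 in probability, then $$\|\widehat{\mathcal A}-\mathcal A\widehat\Pi_K\|_{op}^2=O_p(T^{-1}\alpha_T^{-1}),\qquad \|\mathcal A(\mathcal I-\widehat\Pi_K)\|_{op}^2=o_p(1),$$ and consequently $\|\widehat{\mathcal A}-\mathcal A\|_{op}\to0$ in probability. -/

import Mathlib

open MeasureTheory ProbabilityTheory Filter Topology
open scoped ENNReal NNReal

namespace FIVE

noncomputable section

section Operators

variable {H : Type*} [NormedAddCommGroup H] [InnerProductSpace ℝ H]

/-- The tensor product `x ⊗ y`, i.e. the operator `ζ ↦ ⟪x, ζ⟫ y`. -/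
def tensor (x y : H) : H →L[ℝ] H := InnerProductSpace.rankOne ℝ y x

/-- `(lam j, f j)_{j ≥ 0}` are the pairs of eigenvalues and eigenfunctions of `S`: the `f j` are
orthonormal, the `lam j` are ordered from the largest to the smallest (repeated according to
multiplicity) and tend to zero, and `S = ∑ j, lam j • f j ⊗ f j`.
The index is shifted by one: `lam j` is the `(j+1)`-st largest eigenvalue. -/
structure IsEigenSystem (S : H →L[ℝ] H) (lam : ℕ → ℝ) (f : ℕ → H) : Prop where
  orthonormal : Orthonormal ℝ f
  antitone : Antitone lam
  tendsto_zero : Tendsto lam atTop (𝓝 0)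
  hasSum : ∀ ζ : H, HasSum (fun j => lam j • tensor (f j) (f j) ζ) (S ζ)

/-- `K = #{j : lam j > α}`. -/
def rankK (lam : ℕ → ℝ) (α : ℝ) : ℕ := Set.ncard {j : ℕ | α < lam j}

/-- The orthogonal projection `∑_{j ≤ K} f j ⊗ f j`. -/
def projK (f : ℕ → H) (K : ℕ) : H →L[ℝ] H := ∑ j ∈ Finset.range K, tensor (f j) (f j)

/-- The rank-regularized inverse `∑_{j ≤ K} (lam j)⁻¹ f j ⊗ f j`. -/
def regInv (lam : ℕ → ℝ) (f : ℕ → H) (K : ℕ) : H →L[ℝ] H :=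
  ∑ j ∈ Finset.range K, (lam j)⁻¹ • tensor (f j) (f j)

/-- `τ_j = 2√2 max {(lam_{j-1} - lam_j)⁻¹, (lam_j - lam_{j+1})⁻¹}`, where for the first index only
the gap to the next eigenvalue is present. -/
def tau (lam : ℕ → ℝ) : ℕ → ℝ
  | 0 => 2 * √2 * (lam 0 - lam 1)⁻¹
  | j + 1 => 2 * √2 * max (lam j - lam (j + 1))⁻¹ (lam (j + 1) - lam (j + 2))⁻¹

/-- `τ_1 + ⋯ + τ_K`. -/
def tauSum (lam : ℕ → ℝ) (K : ℕ) : ℝ := ∑ j ∈ Finset.range K, tau lam j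

variable [CompleteSpace H]

/-- The Hilbert–Schmidt norm `(∑ ‖S e_j‖²)^{1/2} ∈ [0, ∞]`, computed in some orthonormal basis
`(e_j)` of `H`; the value does not depend on the basis. -/
def hsNorm (S : H →L[ℝ] H) : ℝ≥0∞ :=
  (∑' e : (exists_hilbertBasis ℝ H).choose, ‖S (e : H)‖ₑ ^ 2) ^ (1 / 2 : ℝ)

end Operators

section EigenSystemExists

variable {H : Type*} [NormedAddCommGroup H] [InnerProductSpace ℝ H] [CompleteSpace H]

theorem exists_top_eigenvector [Nontrivial H] (S : H →L[ℝ] H) (hc : IsCompactOperator S)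
    (hp : S.IsPositive) : ∃ v : H, ‖v‖ = 1 ∧ S v = ‖S‖ • v := by
  by_cases h0 : S = 0
  · obtain ⟨v, hv⟩ := exists_norm_eq H (zero_le_one (α := ℝ))
    exact ⟨v, hv, by simp [h0]⟩
  have hsym : S.IsSymmetric := hp.isSymmetric
  have hr := S.spectralRadius_eq_nnnorm hp.isSelfAdjoint
  have hne : (spectrum ℝ S).Nonempty := by
    by_contra hcon
    rw [Set.not_nonempty_iff_eq_empty] at hcon
    simp [spectralRadius, hcon] at hr
    exact h0 (nnnorm_eq_zero.1 hr.symm)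
  obtain ⟨k, hk, hk'⟩ := spectrum.exists_nnnorm_eq_spectralRadius_of_nonempty hne
  rw [hr] at hk'
  have hk1 : ‖k‖ = ‖S‖ := by
    have := ENNReal.coe_injective hk'
    exact congrArg NNReal.toReal this
  have hk0 : k ≠ 0 := by
    intro h; rw [h, norm_zero] at hk1; exact h0 (norm_eq_zero.1 hk1.symm)
  have hev := (hc.hasEigenvalue_iff_mem_spectrum hk0).2 hk
  have hnn : 0 ≤ k := eigenvalue_nonneg_of_nonneg hev
    (fun x => by simpa using hp.inner_nonneg_right x)
  obtain ⟨w, hw⟩ := hev.exists_hasEigenvector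
  have hw1 : S w = k • w := hw.apply_eq_smul
  have hw0 : w ≠ 0 := hw.2
  refine ⟨‖w‖⁻¹ • w, by simp [norm_smul, hw0], ?_⟩
  rw [map_smul, hw1, ← hk1, Real.norm_of_nonneg hnn, smul_comm]

theorem exists_next_eigenvector (hinf : ¬ FiniteDimensional ℝ H) (S : H →L[ℝ] H)
    (hc : IsCompactOperator S) (hp : S.IsPositive) (V : Submodule ℝ H) [FiniteDimensional ℝ V]
    (hV : ∀ x ∈ V, S x ∈ V) :
    ∃ (v : H) (k : ℝ), v ∈ Vᗮ ∧ ‖v‖ = 1 ∧ 0 ≤ k ∧ S v = k • v ∧ ∀ w ∈ Vᗮ, ‖S w‖ ≤ k * ‖w‖ := by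
  have hV' : ∀ x ∈ Vᗮ, S x ∈ Vᗮ := by
    intro x hx
    rw [Submodule.mem_orthogonal] at hx ⊢
    intro y hy
    have := hp.isSymmetric y x
    simp only [ContinuousLinearMap.coe_coe] at this
    rw [← this]
    exact hx _ (hV y hy)
  have : Nontrivial Vᗮ := by
    rw [Submodule.nontrivial_iff_ne_bot]
    intro h
    rw [Submodule.orthogonal_eq_bot_iff] at h
    subst h
    exact hinf (Module.Finite.equiv (Submodule.topEquiv (R := ℝ) (M := H)))
  let R : Vᗮ →L[ℝ] Vᗮ := S.restrict hV'
  have hR : ∀ w : Vᗮ, ((R w : Vᗮ) : H) = S w := fun _ => rfl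
  have hRc : IsCompactOperator R := hc.restrict' hV'
  have hRp : R.IsPositive := by
    rw [ContinuousLinearMap.isPositive_iff]
    refine ⟨hp.isSymmetric.restrict_invariant hV', fun w => ?_⟩
    have := hp.inner_nonneg_left (w : H)
    simpa [Submodule.coe_inner, hR] using this
  obtain ⟨v, hv1, hv2⟩ := exists_top_eigenvector R hRc hRp
  refine ⟨v, ‖R‖, v.2, by simpa using hv1, norm_nonneg R, ?_, fun w hw => ?_⟩
  · rw [← hR, hv2]; rfl
  · exact R.le_opNorm ⟨w, hw⟩

/-- Every compact positive operator on an infinite-dimensional Hilbert space has a system of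
eigenvalues and eigenfunctions in the above sense. -/
theorem exists_isEigenSystem (hinf : ¬ FiniteDimensional ℝ H) (S : H →L[ℝ] H)
    (hc : IsCompactOperator S) (hp : S.IsPositive) :
    ∃ (lam : ℕ → ℝ) (f : ℕ → H), IsEigenSystem S lam f := by
  let St := {V : Submodule ℝ H // FiniteDimensional ℝ V ∧ ∀ x ∈ V, S x ∈ V}
  have hstep : ∀ V : St, ∃ (v : H) (k : ℝ), v ∈ V.1ᗮ ∧ ‖v‖ = 1 ∧ 0 ≤ k ∧ S v = k • v ∧
      ∀ w ∈ V.1ᗮ, ‖S w‖ ≤ k * ‖w‖ := fun V =>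
    haveI := V.2.1
    exists_next_eigenvector hinf S hc hp V.1 V.2.2
  choose v k h1 h2 h3 h4 h5 using hstep
  let next : St → St := fun V => ⟨V.1 ⊔ ℝ ∙ v V, by
    have := V.2.1
    refine ⟨inferInstance, fun x hx => ?_⟩
    obtain ⟨a, ha, b, hb, rfl⟩ := Submodule.mem_sup.1 hx
    obtain ⟨c, rfl⟩ := Submodule.mem_span_singleton.1 hb
    rw [map_add, map_smul, h4]
    exact Submodule.add_mem_sup (V.2.2 a ha) (Submodule.smul_mem _ _
      (Submodule.smul_mem _ _ (Submodule.mem_span_singleton_self _)))⟩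
  let V : ℕ → St := fun n => Nat.rec ⟨⊥, inferInstance, by simp⟩ (fun _ W => next W) n
  have hVs : ∀ n, (V (n + 1)).1 = (V n).1 ⊔ ℝ ∙ v (V n) := fun n => rfl
  have hmono : Monotone fun n => (V n).1 := monotone_nat_of_le_succ fun n => by
    rw [hVs]; exact le_sup_left
  let f : ℕ → H := fun n => v (V n)
  let lam : ℕ → ℝ := fun n => k (V n)
  have hfmem : ∀ {m n}, m < n → f m ∈ (V n).1 := fun {m n} hmn =>
    hmono (Nat.succ_le_of_lt hmn) (by
      show f m ∈ (V (m + 1)).1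
      rw [hVs]; exact Submodule.mem_sup_right (Submodule.mem_span_singleton_self _))
  have hlt : ∀ {m n}, m < n → inner ℝ (f m) (f n) = 0 := fun {m n} hmn =>
    (Submodule.mem_orthogonal _ _).1 (h1 (V n)) _ (hfmem hmn)
  have hort : Orthonormal ℝ f := by
    refine ⟨fun n => h2 _, fun m n hmn => ?_⟩
    rcases lt_or_gt_of_ne hmn with h | h
    · exact hlt h
    · rw [real_inner_comm]; exact hlt h
  have hSf : ∀ n, S (f n) = lam n • f n := fun n => h4 _
  have hlam0 : ∀ n, 0 ≤ lam n := fun n => h3 _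
  have hf1 : ∀ n, ‖f n‖ = 1 := fun n => h2 _
  have hanti : Antitone lam := antitone_nat_of_succ_le fun n => by
    have : ‖lam (n + 1) • f (n + 1)‖ ≤ lam n * ‖f (n + 1)‖ := by
      rw [← hSf (n + 1)]
      exact h5 (V n) (f (n + 1)) (Submodule.orthogonal_le (hmono n.le_succ) (h1 (V (n + 1))))
    rw [norm_smul, hf1 (n + 1), mul_one, mul_one] at this
    exact (le_abs_self _).trans this
  have htend : Tendsto lam atTop (𝓝 0) := by
    have hbdd : BddBelow (Set.range lam) := ⟨0, by rintro _ ⟨n, rfl⟩; exact hlam0 n⟩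
    have hl := tendsto_atTop_ciInf hanti hbdd
    set l := ⨅ n, lam n with hldef
    have hle : ∀ n, l ≤ lam n := fun n => ciInf_le hbdd n
    have hl0 : 0 ≤ l := le_ciInf hlam0
    rcases hl0.eq_or_lt with h | h
    · rw [h]; exact hl
    exfalso
    obtain ⟨K, hK, hKS⟩ := IsCompactOperator.image_closedBall_subset_compact (𝕜₁ := ℝ) (f := (S : H →ₗ[ℝ] H)) hc 1
    obtain ⟨a, -, φ, hφ, ha⟩ := hK.tendsto_subseq (x := fun n => S (f n)) fun n =>
      hKS ⟨f n, by simp [hf1], rfl⟩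
    have hcau := ha.cauchySeq
    rw [Metric.cauchySeq_iff'] at hcau
    obtain ⟨N, hN⟩ := hcau l h
    have h1' := hN (N + 1) N.le_succ
    have hne : φ (N + 1) ≠ φ N := (hφ N.lt_succ_self).ne'
    rw [dist_eq_norm] at h1'
    simp only [Function.comp, hSf] at h1'
    have h2' : ‖lam (φ (N + 1)) • f (φ (N + 1)) - lam (φ N) • f (φ N)‖ ^ 2
        = lam (φ (N + 1)) ^ 2 + lam (φ N) ^ 2 := by
      rw [@norm_sub_sq ℝ, norm_smul, norm_smul, hf1, hf1, inner_smul_left, inner_smul_right,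
        hort.2 hne]
      simp
    have h3' := pow_lt_pow_left₀ h1' (norm_nonneg _) two_ne_zero
    rw [h2'] at h3'
    nlinarith [hle (φ N), hle (φ (N + 1)), sq_nonneg (lam (φ (N + 1))),
      pow_le_pow_left₀ hl0 (hle (φ N)) 2]
  refine ⟨lam, f, hort, hanti, htend, fun ζ => ?_⟩
  have hterm : ∀ j, lam j • tensor (f j) (f j) ζ = (lam j * inner ℝ (f j) ζ) • f j := fun j => by
    simp [tensor, smul_smul]
  simp only [hterm]
  have hsum : Summable fun j => (lam j * inner ℝ (f j) ζ) • f j := by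
    have hof := hort.orthogonalFamily
    have := hof.summable_iff_norm_sq_summable (fun j => lam j * inner ℝ (f j) ζ)
    simp only [LinearIsometry.toSpanSingleton_apply] at this
    rw [this]
    refine Summable.of_nonneg_of_le (fun _ => sq_nonneg _) (fun j => ?_)
      ((hort.inner_products_summable (x := ζ)).mul_left (lam 0 ^ 2))
    rw [norm_mul, mul_pow]
    refine mul_le_mul_of_nonneg_right ?_ (sq_nonneg _)
    rw [Real.norm_of_nonneg (hlam0 _)]
    exact pow_le_pow_left₀ (hlam0 _) (hanti (Nat.zero_le j)) 2
  refine (hsum.hasSum_iff_tendsto_nat).2 ?_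
  rw [tendsto_iff_norm_sub_tendsto_zero]
  refine squeeze_zero (fun _ => norm_nonneg _) (fun n => ?_)
    (by simpa using htend.mul_const ‖ζ‖)
  have hperp : ∀ n, ∀ y ∈ (V n).1,
      inner ℝ y (ζ - ∑ j ∈ Finset.range n, inner ℝ (f j) ζ • f j) = 0 := by
    intro n
    induction n with
    | zero =>
      intro y hy
      have : y = 0 := (Submodule.mem_bot ℝ).1 hy
      simp [this]
    | succ n ih =>
      intro y hy
      rw [hVs] at hy
      obtain ⟨a, ha, b, hb, rfl⟩ := Submodule.mem_sup.1 hy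
      obtain ⟨c, rfl⟩ := Submodule.mem_span_singleton.1 hb
      have ha' : inner ℝ a (f n) = 0 := (Submodule.mem_orthogonal _ _).1 (h1 (V n)) a ha
      have e1 : inner ℝ a (ζ - ∑ j ∈ Finset.range (n + 1), inner ℝ (f j) ζ • f j) = 0 := by
        rw [Finset.sum_range_succ, ← sub_sub, inner_sub_right, ih a ha, inner_smul_right, ha']
        simp
      have e2 : inner ℝ (f n) (ζ - ∑ j ∈ Finset.range (n + 1), inner ℝ (f j) ζ • f j) = 0 := by
        rw [inner_sub_right, hort.inner_right_sum _ (Finset.self_mem_range_succ n), sub_self]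
      rw [inner_add_left, e1, inner_smul_left]
      change 0 + _ * inner ℝ (f n) _ = 0
      rw [e2]; simp
  set s := ∑ j ∈ Finset.range n, inner ℝ (f j) ζ • f j with hs
  have hsV : s ∈ (V n).1 := Submodule.sum_mem _ fun j hj =>
    Submodule.smul_mem _ _ (hfmem (Finset.mem_range.1 hj))
  have hSs : ∑ j ∈ Finset.range n, (lam j * inner ℝ (f j) ζ) • f j = S s := by
    rw [hs, map_sum]
    refine Finset.sum_congr rfl fun j _ => ?_
    rw [map_smul, hSf, smul_smul, mul_comm]
  rw [hSs, norm_sub_rev, ← map_sub]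
  have hb : ‖S (ζ - s)‖ ≤ lam n * ‖ζ - s‖ :=
    h5 (V n) _ ((Submodule.mem_orthogonal _ _).2 (hperp n))
  have hn : ‖ζ - s‖ ≤ ‖ζ‖ := by
    have h0 := hperp n s hsV
    have h1' : ‖ζ - s‖ ^ 2 = inner ℝ ζ (ζ - s) := by
      rw [← real_inner_self_eq_norm_sq]
      nth_rewrite 1 [inner_sub_left]
      rw [h0, sub_zero]
    have h2' := real_inner_le_norm ζ (ζ - s)
    by_contra! hcon
    nlinarith [norm_nonneg ζ, norm_nonneg (ζ - s)]
  exact hb.trans (mul_le_mul_of_nonneg_left hn (hlam0 n))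

end EigenSystemExists

section Probability

variable {Ω : Type*} [MeasurableSpace Ω]

/-- `X_T = O_p(a_T)` as `T → ∞`. -/
def IsBigOp (μ : Measure Ω) (X : ℕ → Ω → ℝ≥0∞) (a : ℕ → ℝ) : Prop :=
  ∀ ε : ℝ≥0∞, 0 < ε → ∃ M : ℝ≥0, ∀ᶠ T in atTop,
    μ {ω | (M : ℝ≥0∞) * ENNReal.ofReal (a T) < X T ω} ≤ ε

/-- `X_T = o_p(1)` as `T → ∞`. -/
def IsLittleOp (μ : Measure Ω) (X : ℕ → Ω → ℝ≥0∞) : Prop :=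
  ∀ ε : ℝ≥0∞, 0 < ε → Tendsto (fun T => μ {ω | ε ≤ X T ω}) atTop (𝓝 0)

/-- `g` is a version of the conditional expectation of the `[0, ∞]`-valued random variable `h`
given the σ-algebra `m`. -/
def IsCondLExp (μ : Measure Ω) (m : MeasurableSpace Ω) (h g : Ω → ℝ≥0∞) : Prop :=
  Measurable[m] g ∧ ∀ s : Set Ω, MeasurableSet[m] s → ∫⁻ ω in s, g ω ∂μ = ∫⁻ ω in s, h ω ∂μ

/-- Strict stationarity of `(w_t)_{t ≥ 1}`: the law of the whole sequence is invariant under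
shifts of time. -/
def IsStationarySeq {E : Type*} [MeasurableSpace E] (μ : Measure Ω) (w : ℕ → Ω → E) : Prop :=
  ∀ k : ℕ, Measure.map (fun ω (t : ℕ) => w (t + 1 + k) ω) μ
    = Measure.map (fun ω (t : ℕ) => w (t + 1) ω) μ

/-- Geometric strong mixing of `(w_t)_{t ≥ 1}`: the strong mixing coefficients
`sup_{t ≥ 1} sup {|P(B ∩ D) - P(B) P(D)| : B ∈ σ(w_s, s ≤ t), D ∈ σ(w_s, s ≥ t + n)}`
are bounded by `c rⁿ` for some `c` and some `0 < r < 1`. -/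
def IsGeomStrongMixing {E : Type*} [MeasurableSpace E] (μ : Measure Ω) (w : ℕ → Ω → E) : Prop :=
  ∃ c r : ℝ, 0 < r ∧ r < 1 ∧ ∀ t n : ℕ, 1 ≤ t → 1 ≤ n → ∀ B D : Set Ω,
    MeasurableSet[⨆ s ∈ Set.Icc 1 t, MeasurableSpace.comap (w s) inferInstance] B →
    MeasurableSet[⨆ s ∈ Set.Ici (t + n), MeasurableSpace.comap (w s) inferInstance] D →
    |μ.real (B ∩ D) - μ.real B * μ.real D| ≤ c * r ^ n

variable {H : Type*} [NormedAddCommGroup H] [InnerProductSpace ℝ H]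

/-- The sample (cross-)covariance operator `T⁻¹ ∑_{t=1}^T x_t ⊗ z_t`. -/
def sampleCov (x z : ℕ → Ω → H) (T : ℕ) (ω : Ω) : H →L[ℝ] H :=
  (T : ℝ)⁻¹ • ∑ t ∈ Finset.Icc 1 T, tensor (x t ω) (z t ω)

/-- The FIVE `Ĉ_yz* Ĉ_xz (Ĉ_xz* Ĉ_xz)_K⁻¹` computed from the eigenelements `(lam, f)` of
`Ĉ_xz* Ĉ_xz` with threshold parameter `α`. -/
def five [CompleteSpace H] (x y z : ℕ → Ω → H) (α : ℝ) (T : ℕ) (ω : Ω)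
    (lam : ℕ → ℝ) (f : ℕ → H) : H →L[ℝ] H :=
  (sampleCov y z T ω).adjoint ∘L sampleCov x z T ω ∘L regInv lam f (rankK lam α)

variable [MeasurableSpace H]

/-- `𝔉_t = σ({z_s}_{1 ≤ s ≤ t+1}, {u_s}_{1 ≤ s ≤ t})`. -/
abbrev info (z u : ℕ → Ω → H) (t : ℕ) : MeasurableSpace Ω :=
  (⨆ s ∈ Set.Icc 1 (t + 1), MeasurableSpace.comap (z s) inferInstance) ⊔
    ⨆ s ∈ Set.Icc 1 t, MeasurableSpace.comap (u s) inferInstance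

/-- The (cross-)covariance operator `E[x_t ⊗ z_t]` of two zero-mean sequences, at `t = 1` (under
the assumptions below it does not depend on `t`). -/
def popCov (μ : Measure Ω) (x z : ℕ → Ω → H) : H →L[ℝ] H :=
  ∫ ω, tensor (x 1 ω) (z 1 ω) ∂μ

/-- The standing assumptions on the functional endogenous linear model `y_t = A x_t + u_t` with
instrument `z_t`; `lam` is the sequence of eigenvalues of `C_xz* C_xz`. -/
structure Assumption1 [CompleteSpace H] (μ : Measure Ω) (x y z u : ℕ → Ω → H) (A : H →L[ℝ] H)
    (lam : ℕ → ℝ) : Prop where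
  measurable_x : ∀ t, 1 ≤ t → Measurable (x t)
  measurable_y : ∀ t, 1 ≤ t → Measurable (y t)
  measurable_z : ∀ t, 1 ≤ t → Measurable (z t)
  measurable_u : ∀ t, 1 ≤ t → Measurable (u t)
  /-- the model equation -/
  model : ∀ t, 1 ≤ t → ∀ᵐ ω ∂μ, y t ω = A (x t ω) + u t ω
  /-- second moments -/
  memLp_x : ∀ t, 1 ≤ t → MemLp (x t) 2 μ
  memLp_z : ∀ t, 1 ≤ t → MemLp (z t) 2 μ
  memLp_u : ∀ t, 1 ≤ t → MemLp (u t) 2 μ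
  /-- zero means -/
  mean_x : ∀ t, 1 ≤ t → ∫ ω, x t ω ∂μ = 0
  mean_z : ∀ t, 1 ≤ t → ∫ ω, z t ω ∂μ = 0
  mean_u : ∀ t, 1 ≤ t → ∫ ω, u t ω ∂μ = 0
  /-- endogeneity -/
  endogenous : ∀ t, 1 ≤ t → ∫ ω, tensor (x t ω) (u t ω) ∂μ ≠ 0
  stationary : IsStationarySeq μ (fun t ω => (x t ω, z t ω))
  mixing : IsGeomStrongMixing μ (fun t ω => (x t ω, z t ω))
  /-- exogeneity of the instrument -/
  condMean_u : ∀ t, 1 ≤ t → μ[u t | info z u (t - 1)] =ᵐ[μ] 0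
  /-- homoscedasticity -/
  condCov_u : ∀ t, 1 ≤ t → μ[fun ω => tensor (u t ω) (u t ω) | info z u (t - 1)]
    =ᵐ[μ] fun _ => popCov μ u u
  /-- `sup_{1 ≤ t ≤ T} E[‖u_t‖^{2+δ} | 𝔉_{t-1}] < ∞` almost surely for some `δ > 0` -/
  condMoment_u : ∃ δ : ℝ, 0 < δ ∧ ∃ g : ℕ → Ω → ℝ≥0∞,
    (∀ t, 1 ≤ t → IsCondLExp μ (info z u (t - 1)) (fun ω => ‖u t ω‖ₑ ^ (2 + δ)) (g t)) ∧
    ∀ T : ℕ, ∀ᵐ ω ∂μ, (⨆ t ∈ Finset.Icc 1 T, g t ω) < ∞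
  /-- identification -/
  ker_eq_bot : LinearMap.ker
    (((popCov μ x z).adjoint ∘L popCov μ x z : H →L[ℝ] H) : H →ₗ[ℝ] H) = ⊥
  hilbertSchmidt : hsNorm A < ∞
  /-- distinct positive eigenvalues of `C_xz* C_xz` -/
  lam_strictAnti : StrictAnti lam
  lam_pos : ∀ j, 0 < lam j
  /-- convergence of the sample operators -/
  rate_xz : IsBigOp μ (fun T ω => hsNorm (sampleCov x z T ω - popCov μ x z))
    (fun T => (T : ℝ) ^ (-(1 / 2) : ℝ))
  rate_zz : IsBigOp μ (fun T ω => hsNorm (sampleCov z z T ω - popCov μ z z))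
    (fun T => (T : ℝ) ^ (-(1 / 2) : ℝ))
  rate_uz : IsBigOp μ (fun T ω => hsNorm (sampleCov u z T ω - popCov μ u z))
    (fun T => (T : ℝ) ^ (-(1 / 2) : ℝ))
  conv_uu : IsLittleOp μ (fun T ω => hsNorm (sampleCov u u T ω - popCov μ u u))

end Probability

section Existence

theorem isCompactOperator_tensor {H : Type*} [NormedAddCommGroup H] [InnerProductSpace ℝ H]
    (x y : H) : IsCompactOperator (tensor x y) := by
  have h1 : IsCompactOperator (ContinuousLinearMap.toSpanSingleton ℝ y) :=
    ⟨_, (isCompact_closedBall (0 : ℝ) 1).image (ContinuousLinearMap.toSpanSingleton ℝ y).continuous,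
      mem_of_superset (Metric.closedBall_mem_nhds 0 one_pos) fun r hr => ⟨r, hr, rfl⟩⟩
  exact h1.comp_clm (innerSL ℝ x)

/-- The sample operator `Ĉ_xz* Ĉ_xz` always has a system of eigenelements. -/
theorem exists_isEigenSystem_sampleCov {Ω : Type*} {H : Type*} [NormedAddCommGroup H]
    [InnerProductSpace ℝ H] [CompleteSpace H] (hinf : ¬ FiniteDimensional ℝ H)
    (x z : ℕ → Ω → H) (T : ℕ) (ω : Ω) : ∃ (lam : ℕ → ℝ) (f : ℕ → H),
      IsEigenSystem ((sampleCov x z T ω).adjoint ∘L sampleCov x z T ω) lam f := by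
  have hc : IsCompactOperator (sampleCov x z T ω) := by
    have : sampleCov x z T ω ∈ compactOperator (RingHom.id ℝ) H H :=
      Submodule.smul_mem _ _ (Submodule.sum_mem _ fun t _ => isCompactOperator_tensor _ _)
    exact this
  exact exists_isEigenSystem hinf _ (hc.clm_comp (sampleCov x z T ω).adjoint)
    (ContinuousLinearMap.isPositive_adjoint_comp_self _)

/-- The population operator `C_xz* C_xz` always has a system of eigenelements. -/
theorem exists_isEigenSystem_popCov {Ω : Type*} [MeasurableSpace Ω] (μ : Measure Ω)
    [IsProbabilityMeasure μ] {H : Type*} [NormedAddCommGroup H]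
    [InnerProductSpace ℝ H] [CompleteSpace H] (hinf : ¬ FiniteDimensional ℝ H)
    (x z : ℕ → Ω → H) : ∃ (lam : ℕ → ℝ) (f : ℕ → H),
      IsEigenSystem ((popCov μ x z).adjoint ∘L popCov μ x z) lam f := by
  have hc : IsCompactOperator (popCov μ x z) := by
    have : popCov μ x z ∈ compactOperator (RingHom.id ℝ) H H := by
      by_cases hi : Integrable (fun ω => tensor (x 1 ω) (z 1 ω)) μ
      · exact (compactOperator (RingHom.id ℝ) H H).convex.integral_mem
          isClosed_setOfPred_isCompactOperator
          (Eventually.of_forall fun ω => isCompactOperator_tensor _ _) hi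
      · rw [popCov, integral_undef hi]; exact Submodule.zero_mem _
    exact this
  exact exists_isEigenSystem hinf _ (hc.clm_comp (popCov μ x z).adjoint)
    (ContinuousLinearMap.isPositive_adjoint_comp_self _)

end Existence

end

end FIVE

/-! Write `Ĉ` for the sample and `C` for the population covariance of `x` and `z`, `Π` for the
projection on the `K` leading eigenvectors of `Ĉ*Ĉ`, and `R` for the rank-regularized inverse, so
that `Ĉ*Ĉ R = Π`.

Variance: the model gives `Ĉ_yz* = A Ĉ* + Ĉ_uz*`, hence the estimator minus `A Π` is exactly `Ĉ_uz*
(Ĉ R)`. Spectral calculus gives `‖Ĉ R‖² ≤ 1/α`, and exogeneity gives `C_uz = 0`, so `‖Ĉ_uz‖² =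
O_p(1/T)` (`norm_five_sub_sq_le`, `popCov_eq_zero`).

Bias: since `C` is injective, `C*` has dense range, and a Hilbert–Schmidt `A` is an operator-norm
limit of operators `B C` (`exists_norm_sub_comp_lt`). For fixed `B`, the norm of `B C (I - Π)` is at
most `‖B‖ (‖Ĉ - C‖ + ‖Ĉ (I - Π)‖)`, where `‖Ĉ (I - Π)‖ ≤ √α`. The eigenvectors enter only through
this last bound; both terms vanish as `T → ∞`, and `‖A - B C‖` is as small as desired
(`norm_comp_id_sub_projK_le_add`).

Consistency is the triangle inequality through `A Π`. -/

namespace FIVE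

/-! ### Spectral truncation of a fixed operator. -/

section Deterministic

variable {H : Type*} [NormedAddCommGroup H] [InnerProductSpace ℝ H]

theorem tensor_apply (x y ζ : H) : tensor x y ζ = inner ℝ x ζ • y := by
  simp [tensor]

theorem projK_apply (f : ℕ → H) (K : ℕ) (ζ : H) :
    projK f K ζ = ∑ j ∈ Finset.range K, inner ℝ (f j) ζ • f j := by
  simp [projK, tensor_apply]

theorem regInv_apply (lam : ℕ → ℝ) (f : ℕ → H) (K : ℕ) (ζ : H) :
    regInv lam f K ζ = ∑ j ∈ Finset.range K, (lam j)⁻¹ • inner ℝ (f j) ζ • f j := by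
  simp [regInv, tensor_apply]

/-- Monotonicity makes the indices above the threshold an initial segment. Decay to zero with `0 <
α` makes it finite, which matters because `Set.ncard` of an infinite set is zero. -/
theorem lt_rankK_iff {lam : ℕ → ℝ} (hanti : Antitone lam) (h0 : Tendsto lam atTop (𝓝 0)) {α : ℝ}
    (hα : 0 < α) (j : ℕ) : j < rankK lam α ↔ α < lam j := by
  obtain ⟨N, hN⟩ := (h0.eventually (gt_mem_nhds hα)).exists
  have hex : ∃ n, ¬ α < lam n := ⟨N, hN.le.not_gt⟩
  classical
  have hset : {j : ℕ | α < lam j} = Finset.range (Nat.find hex) := by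
    ext i
    simp only [Set.mem_ofPred_eq, Finset.coe_range, Set.mem_Iio]
    constructor
    · intro hi
      by_contra hle
      exact Nat.find_spec hex (hi.trans_le (hanti (not_lt.1 hle)))
    · intro hi
      exact not_not.1 (Nat.find_min hex hi)
  have hK : rankK lam α = Nat.find hex := by
    rw [rankK, hset, Set.ncard_coe_finset, Finset.card_range]
  have := Set.ext_iff.1 hset j
  simp only [Set.mem_ofPred_eq, Finset.coe_range, Set.mem_Iio] at this
  rw [hK, this]

theorem IsEigenSystem.apply_eigenvector {S : H →L[ℝ] H} {lam : ℕ → ℝ} {f : ℕ → H}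
    (h : IsEigenSystem S lam f) (j : ℕ) : S (f j) = lam j • f j := by
  refine (h.hasSum (f j)).unique ?_
  have := hasSum_single (f := fun i => lam i • tensor (f i) (f i) (f j)) j (fun i hi => by
    rw [tensor_apply, h.orthonormal.2 hi, zero_smul, smul_zero])
  simpa [tensor_apply, h.orthonormal.1 j] using this

theorem inner_sub_projK {f : ℕ → H} (hf : Orthonormal ℝ f) {K j : ℕ} (hj : j < K) (ζ : H) :
    inner ℝ (f j) (ζ - projK f K ζ) = 0 := by
  rw [projK_apply, inner_sub_right, hf.inner_right_sum _ (Finset.mem_range.2 hj), sub_self]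

theorem norm_sub_projK_le {f : ℕ → H} (hf : Orthonormal ℝ f) (K : ℕ) (ζ : H) :
    ‖ζ - projK f K ζ‖ ≤ ‖ζ‖ := by
  have h0 : inner ℝ (projK f K ζ) (ζ - projK f K ζ) = 0 := by
    conv_lhs => rw [projK_apply f K ζ, sum_inner]
    refine Finset.sum_eq_zero fun j hj => ?_
    rw [← projK_apply, inner_smul_left, inner_sub_projK hf (Finset.mem_range.1 hj), mul_zero]
  have h1 : ‖ζ‖ ^ 2 = ‖ζ - projK f K ζ‖ ^ 2 + ‖projK f K ζ‖ ^ 2 := by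
    have := norm_add_sq_real (projK f K ζ) (ζ - projK f K ζ)
    rw [h0, add_sub_cancel] at this
    linarith
  exact (sq_le_sq₀ (norm_nonneg _) (norm_nonneg _)).1 (by nlinarith [sq_nonneg ‖projK f K ζ‖])

/-- The rank-regularized inverse inverts `S` on the span of the first `K` eigenvectors. -/
theorem IsEigenSystem.comp_regInv {S : H →L[ℝ] H} {lam : ℕ → ℝ} {f : ℕ → H}
    (h : IsEigenSystem S lam f) {α : ℝ} (hα : 0 < α) :
    S ∘L regInv lam f (rankK lam α) = projK f (rankK lam α) := by
  ext ζ
  rw [ContinuousLinearMap.comp_apply, regInv_apply, projK_apply, map_sum]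
  refine Finset.sum_congr rfl fun j hj => ?_
  have hlam : lam j ≠ 0 := (hα.trans ((lt_rankK_iff h.antitone h.tendsto_zero hα j).1
    (Finset.mem_range.1 hj))).ne'
  rw [map_smul, map_smul, h.apply_eigenvector, smul_comm _ (lam j), inv_smul_smul₀ hlam]

variable [CompleteSpace H]

theorem norm_sq_eq_inner_adjoint_comp (S : H →L[ℝ] H) (ζ : H) :
    ‖S ζ‖ ^ 2 = inner ℝ ((S.adjoint ∘L S) ζ) ζ := by
  rw [ContinuousLinearMap.comp_apply, ContinuousLinearMap.adjoint_inner_left,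
    real_inner_self_eq_norm_sq]

/-- With `R` the regularized inverse, `‖S R ζ‖² = ⟪S*S R ζ, R ζ⟫ = ⟪Π ζ, R ζ⟫ = ∑_{j<K} lam_j⁻¹
⟪f_j, ζ⟫²`. Every retained `lam_j` exceeds `α`, and Bessel's inequality finishes. -/
theorem norm_comp_regInv_sq_le {S : H →L[ℝ] H} {lam : ℕ → ℝ} {f : ℕ → H}
    (h : IsEigenSystem (S.adjoint ∘L S) lam f) {α : ℝ} (hα : 0 < α) :
    ‖S ∘L regInv lam f (rankK lam α)‖ ^ 2 ≤ α⁻¹ := by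
  have hb : ‖S ∘L regInv lam f (rankK lam α)‖ ≤ √α⁻¹ := by
    refine ContinuousLinearMap.opNorm_le_bound _ (Real.sqrt_nonneg _) fun ζ => ?_
    refine (sq_le_sq₀ (norm_nonneg _) (by positivity)).1 ?_
    rw [mul_pow, Real.sq_sqrt (by positivity), ContinuousLinearMap.comp_apply,
      norm_sq_eq_inner_adjoint_comp, ← ContinuousLinearMap.comp_apply (S.adjoint ∘L S),
      h.comp_regInv hα, projK_apply, regInv_apply, sum_inner]
    refine le_trans ?_ (mul_le_mul_of_nonneg_left
      (h.orthonormal.sum_inner_products_le (s := Finset.range (rankK lam α)) ζ)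
      (by positivity : 0 ≤ α⁻¹))
    rw [Finset.mul_sum]
    refine Finset.sum_le_sum fun j hj => ?_
    have hlam := (lt_rankK_iff h.antitone h.tendsto_zero hα j).1 (Finset.mem_range.1 hj)
    simp only [smul_smul]
    rw [inner_smul_left, h.orthonormal.inner_right_sum _ hj, Real.norm_eq_abs, sq_abs]
    simp only [conj_trivial]
    nlinarith [mul_le_mul_of_nonneg_right ((inv_le_inv₀ (hα.trans hlam) hα).2 hlam.le)
      (sq_nonneg (inner ℝ (f j) ζ))]
  calc _ ≤ √α⁻¹ ^ 2 := pow_le_pow_left₀ (norm_nonneg _) hb 2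
    _ = α⁻¹ := Real.sq_sqrt (by positivity)

/-- For `p = ζ - Π ζ`, `‖S p‖² = ∑ lam_j ⟪f_j, p⟫²`. The terms with `j < K` vanish by orthogonality,
the others have `lam_j ≤ α`, and `‖p‖ ≤ ‖ζ‖`. -/
theorem norm_comp_id_sub_projK_le {S : H →L[ℝ] H} {lam : ℕ → ℝ} {f : ℕ → H}
    (h : IsEigenSystem (S.adjoint ∘L S) lam f) {α : ℝ} (hα : 0 < α) :
    ‖S ∘L (ContinuousLinearMap.id ℝ H - projK f (rankK lam α))‖ ≤ √α := by
  refine ContinuousLinearMap.opNorm_le_bound _ (Real.sqrt_nonneg _) fun ζ => ?_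
  refine (sq_le_sq₀ (norm_nonneg _) (by positivity)).1 ?_
  rw [mul_pow, Real.sq_sqrt hα.le, ContinuousLinearMap.comp_apply,
    norm_sq_eq_inner_adjoint_comp, sub_apply, ContinuousLinearMap.id_apply]
  set p := ζ - projK f (rankK lam α) ζ with hp
  have hs : HasSum (fun j => lam j * inner ℝ (f j) p ^ 2) (inner ℝ ((S.adjoint ∘L S) p) p) := by
    have := (h.hasSum p).mapL (innerSL ℝ p)
    simp only [innerSL_apply_apply, tensor_apply, inner_smul_right] at this
    rw [real_inner_comm]
    refine this.congr_fun fun j => ?_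
    rw [real_inner_comm (f j), sq]
  have hle : inner ℝ ((S.adjoint ∘L S) p) p ≤ α * ∑' j, ‖inner ℝ (f j) p‖ ^ 2 := by
    refine hasSum_le (fun j => ?_) hs
      ((h.orthonormal.inner_products_summable (x := p)).hasSum.mul_left α)
    rw [Real.norm_eq_abs, sq_abs]
    by_cases hj : j < rankK lam α
    · rw [hp, inner_sub_projK h.orthonormal hj]; simp
    · exact mul_le_mul_of_nonneg_right (not_lt.1 fun hlt =>
        hj ((lt_rankK_iff h.antitone h.tendsto_zero hα j).2 hlt)) (sq_nonneg _)
  refine hle.trans (mul_le_mul_of_nonneg_left ?_ hα.le)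
  exact (h.orthonormal.tsum_inner_products_le p).trans
    (pow_le_pow_left₀ (norm_nonneg _) (norm_sub_projK_le h.orthonormal _ ζ) 2)

/-- Control of `A` off the leading sample eigenvectors by how well `A` factors through `C` and how
well the sample operator approximates `C`. -/
theorem norm_comp_id_sub_projK_le_add {S : H →L[ℝ] H} {lam : ℕ → ℝ} {f : ℕ → H}
    (h : IsEigenSystem (S.adjoint ∘L S) lam f) {α : ℝ} (hα : 0 < α) (A B C : H →L[ℝ] H) :
    ‖A ∘L (ContinuousLinearMap.id ℝ H - projK f (rankK lam α))‖
      ≤ ‖A - B ∘L C‖ + ‖B‖ * (‖S - C‖ + √α) := by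
  set P := ContinuousLinearMap.id ℝ H - projK f (rankK lam α) with hP
  have hP1 : ‖P‖ ≤ 1 := ContinuousLinearMap.opNorm_le_bound _ zero_le_one fun ζ => by
    rw [one_mul]; exact norm_sub_projK_le h.orthonormal _ ζ
  -- Inserting `B C` and then writing `C = S - (S - C)` leaves only operators that are small on the
  -- range of `P`.
  have heq : A ∘L P = (A - B ∘L C) ∘L P + B ∘L (S ∘L P - (S - C) ∘L P) := by
    ext ζ
    simp
  have hle : ∀ D : H →L[ℝ] H, ‖D ∘L P‖ ≤ ‖D‖ := fun D =>
    (ContinuousLinearMap.opNorm_comp_le _ _).trans (mul_le_of_le_one_right (norm_nonneg _) hP1)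
  rw [heq]
  refine (norm_add_le _ _).trans (add_le_add (hle _)
    ((ContinuousLinearMap.opNorm_comp_le _ _).trans
      (mul_le_mul_of_nonneg_left ?_ (norm_nonneg _))))
  refine (norm_sub_le _ _).trans ?_
  rw [add_comm]
  exact add_le_add (hle _) (norm_comp_id_sub_projK_le h hα)

/-! ### Hilbert–Schmidt operators and factorization through `C`. -/

/-- It is easier to bound the adjoint, which has the same norm: by Parseval `‖S* v‖² = ∑ ⟪S b_e,
v⟫²`, and Cauchy–Schwarz applies to each term. -/
theorem enorm_sq_le_tsum {ι : Type*} (b : HilbertBasis ι ℝ H) (S : H →L[ℝ] H) :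
    ‖S‖ₑ ^ 2 ≤ ∑' e, ‖S (b e)‖ₑ ^ 2 := by
  by_cases htop : ∑' e : ι, ‖S (b e)‖ₑ ^ 2 = ∞
  · rw [htop]; exact le_top
  have hterm : ∀ e : ι, ‖S (b e)‖ₑ ^ 2 = ENNReal.ofReal (‖S (b e)‖ ^ 2) := fun e => by
    rw [← ofReal_norm, ENNReal.ofReal_pow (norm_nonneg _)]
  have hsum : Summable fun e : ι => ‖S (b e)‖ ^ 2 := by
    have := ENNReal.summable_toReal htop
    refine this.congr fun e => ?_
    rw [hterm, ENNReal.toReal_ofReal (sq_nonneg _)]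
  simp only [hterm]
  rw [← ENNReal.ofReal_tsum_of_nonneg (fun _ => sq_nonneg _) hsum, ← ofReal_norm,
    ← ENNReal.ofReal_pow (norm_nonneg _)]
  refine ENNReal.ofReal_le_ofReal ?_
  have h0 : 0 ≤ ∑' e : ι, ‖S (b e)‖ ^ 2 := tsum_nonneg fun _ => sq_nonneg _
  have hbd : ‖S.adjoint‖ ≤ √(∑' e : ι, ‖S (b e)‖ ^ 2) := by
    refine ContinuousLinearMap.opNorm_le_bound _ (Real.sqrt_nonneg _) fun v => ?_
    refine (sq_le_sq₀ (norm_nonneg _) (by positivity)).1 ?_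
    rw [mul_pow, Real.sq_sqrt h0]
    have hp := b.hasSum_inner_mul_inner (S.adjoint v) (S.adjoint v)
    rw [real_inner_self_eq_norm_sq] at hp
    refine hasSum_le (fun e => ?_) hp (hsum.hasSum.mul_right (‖v‖ ^ 2))
    rw [real_inner_comm (b e), ContinuousLinearMap.adjoint_inner_right]
    have h1 := abs_le.1 (abs_real_inner_le_norm (S (b e)) v)
    rw [← sq, ← mul_pow]
    exact sq_le_sq' h1.1 h1.2
  rw [LinearIsometryEquiv.norm_map] at hbd
  calc _ ≤ _ := pow_le_pow_left₀ (norm_nonneg _) hbd 2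
    _ = _ := Real.sq_sqrt h0

theorem enorm_le_hsNorm (S : H →L[ℝ] H) : ‖S‖ₑ ≤ hsNorm S := by
  obtain ⟨b, hb⟩ := (exists_hilbertBasis ℝ H).choose_spec
  have key := enorm_sq_le_tsum b S
  simp only [hb] at key
  have := ENNReal.rpow_le_rpow key (by norm_num : (0 : ℝ) ≤ 1 / 2)
  rwa [← ENNReal.rpow_natCast, ← ENNReal.rpow_mul, show ((2 : ℕ) : ℝ) * (1 / 2) = 1 by norm_num,
    ENNReal.rpow_one] at this

/-- A Hilbert–Schmidt operator lies in every closed subspace of operators which contains all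
operators of rank one. -/
theorem mem_of_hsNorm_lt_top {A : H →L[ℝ] H} (hA : hsNorm A < ∞) (M : Submodule ℝ (H →L[ℝ] H))
    (hM : IsClosed (M : Set (H →L[ℝ] H))) (h1 : ∀ x y : H, tensor x y ∈ M) : A ∈ M := by
  have hort : Orthonormal ℝ (fun e : (exists_hilbertBasis ℝ H).choose => (e : H)) := by
    obtain ⟨b, hb⟩ := (exists_hilbertBasis ℝ H).choose_spec
    exact hb ▸ b.orthonormal
  have hfin : ∑' e : (exists_hilbertBasis ℝ H).choose, ‖A (e : H)‖ₑ ^ 2 ≠ ∞ := by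
    intro h
    rw [hsNorm, h, ENNReal.top_rpow_of_pos (by norm_num)] at hA
    exact lt_irrefl _ hA
  have ht := ENNReal.tendsto_tsum_compl_atTop_zero hfin
  set w := (exists_hilbertBasis ℝ H).choose with hw
  classical
  -- Finite-rank truncations of `A`: `A - B s` kills the basis vectors in `s` and agrees with `A` on
  -- the others, so its squared Hilbert–Schmidt norm is a tail of a convergent series.
  let B : Finset w → H →L[ℝ] H := fun s => ∑ e ∈ s, tensor (e : H) (A e)
  have hBe : ∀ s (e : w), ‖(A - B s) (e : H)‖ₑ ^ 2 = if e ∈ s then 0 else ‖A (e : H)‖ₑ ^ 2 := by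
    intro s e
    have : B s (e : H) = if e ∈ s then A e else 0 := by
      simp only [B, sum_apply, tensor_apply]
      simp only [orthonormal_iff_ite.1 hort, ite_smul, one_smul, zero_smul, Finset.sum_ite_eq']
    rw [sub_apply, this]
    split_ifs <;> simp
  have hnorm : ∀ s, ‖A - B s‖ₑ ≤ (∑' e : {e // e ∉ s}, ‖A ((e : w) : H)‖ₑ ^ 2) ^ (1 / 2 : ℝ) := by
    intro s
    refine (enorm_le_hsNorm _).trans (le_of_eq ?_)
    rw [hsNorm]
    congr 1
    rw [← hw]
    have := tsum_subtype {e : w | e ∉ s} (fun e : w => ‖A (e : H)‖ₑ ^ 2)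
    refine Eq.trans ?_ this.symm
    refine tsum_congr fun e => ?_
    rw [hBe]
    by_cases he : e ∈ s <;> simp [he]
  have hlim : Tendsto B atTop (𝓝 A) := by
    rw [tendsto_iff_edist_tendsto_0]
    have h2 := (ENNReal.continuous_rpow_const (y := 1 / 2)).tendsto 0 |>.comp ht
    rw [ENNReal.zero_rpow_of_pos (by norm_num)] at h2
    refine tendsto_of_tendsto_of_tendsto_of_le_of_le tendsto_const_nhds h2 (fun _ => zero_le)
      fun s => ?_
    rw [edist_comm, edist_eq_enorm_sub]
    exact hnorm s
  exact hM.mem_of_tendsto hlim (Eventually.of_forall fun s =>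
    Submodule.sum_mem _ fun e _ => h1 _ _)

/-- The orthogonal complement of the range of `C*` is `ker C`, which is contained in `ker C*C`. -/
theorem denseRange_adjoint {C : H →L[ℝ] H}
    (hC : LinearMap.ker ((C.adjoint ∘L C : H →L[ℝ] H) : H →ₗ[ℝ] H) = ⊥) :
    DenseRange C.adjoint := by
  have hk : C.ker = ⊥ := by
    rw [Submodule.eq_bot_iff]
    intro v hv
    have hv' : C v = 0 := hv
    have : v ∈ LinearMap.ker ((C.adjoint ∘L C : H →L[ℝ] H) : H →ₗ[ℝ] H) := by
      simp [LinearMap.mem_ker, hv']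
    rw [hC] at this
    exact (Submodule.mem_bot ℝ).1 this
  have h := C.adjoint.orthogonal_range
  rw [ContinuousLinearMap.adjoint_adjoint, hk, ← Submodule.topologicalClosure_eq_top_iff] at h
  exact Submodule.dense_iff_topologicalClosure_eq_top.2 h

/-- A Hilbert–Schmidt operator is approximated in operator norm by operators which factor through
a given injective operator. -/
theorem exists_norm_sub_comp_lt {A C : H →L[ℝ] H} (hA : hsNorm A < ∞)
    (hC : LinearMap.ker ((C.adjoint ∘L C : H →L[ℝ] H) : H →ₗ[ℝ] H) = ⊥) {ε : ℝ} (hε : 0 < ε) :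
    ∃ B : H →L[ℝ] H, ‖A - B ∘L C‖ < ε := by
  let L : (H →L[ℝ] H) →ₗ[ℝ] (H →L[ℝ] H) :=
    { toFun := fun B => B ∘L C
      map_add' := fun _ _ => rfl
      map_smul' := fun _ _ => rfl }
  have hmem : A ∈ (LinearMap.range L).topologicalClosure := by
    refine mem_of_hsNorm_lt_top hA _ (Submodule.isClosed_topologicalClosure _) fun x y => ?_
    have hcont : Continuous fun x : H => tensor x y := by
      have : (fun x : H => tensor x y) = fun x => (innerSL ℝ x).smulRight y := by
        ext x ζ; simp [tensor_apply]
      rw [this]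
      fun_prop
    have hcl : IsClosed {x : H | tensor x y ∈ (LinearMap.range L).topologicalClosure} :=
      (Submodule.isClosed_topologicalClosure _).preimage hcont
    -- By density and continuity in `x` it suffices to take `x = C* v`, and then `(C* v) ⊗ y = (v ⊗
    -- y) ∘ C` factors exactly.
    refine (denseRange_adjoint hC).induction_on (p := fun x =>
      tensor x y ∈ (LinearMap.range L).topologicalClosure) x hcl fun v => ?_
    refine Submodule.le_topologicalClosure _ ⟨tensor v y, ?_⟩
    ext ζ
    change tensor v y (C ζ) = _
    rw [tensor_apply, tensor_apply, ContinuousLinearMap.adjoint_inner_left]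
  obtain ⟨_, ⟨B, rfl⟩, hB⟩ := Metric.mem_closure_iff.1 hmem ε hε
  exact ⟨B, by rwa [dist_eq_norm] at hB⟩

end Deterministic

/-! ### Algebra of the estimator for a fixed sample. -/

section SampleCovariance

variable {Ω : Type*} {H : Type*} [NormedAddCommGroup H] [InnerProductSpace ℝ H] [CompleteSpace H]

/-- Summand by summand, `(A x) ⊗ z = (x ⊗ z) A*`; the claim is the adjoint of the averaged identity.
-/
theorem sampleCov_adjoint_model {x y z u : ℕ → Ω → H} {A : H →L[ℝ] H} {T : ℕ}
    {ω : Ω} (h : ∀ t, 1 ≤ t → y t ω = A (x t ω) + u t ω) :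
    (sampleCov y z T ω).adjoint
      = A ∘L (sampleCov x z T ω).adjoint + (sampleCov u z T ω).adjoint := by
  have : sampleCov y z T ω = sampleCov x z T ω ∘L A.adjoint + sampleCov u z T ω := by
    ext ζ
    simp only [sampleCov, smul_apply, sum_apply,
      add_apply, ContinuousLinearMap.comp_apply, tensor_apply, ← smul_add,
      ← Finset.sum_add_distrib, ← add_smul]
    congr 1
    refine Finset.sum_congr rfl fun t ht => ?_
    rw [h t (Finset.mem_Icc.1 ht).1, inner_add_left, ContinuousLinearMap.adjoint_inner_right]
  rw [this, map_add, ContinuousLinearMap.adjoint_comp, ContinuousLinearMap.adjoint_adjoint]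

/-- The signal part `A Ĉ*Ĉ R` of the estimator equals `A Π` and cancels exactly, leaving `Ĉ_uz* (Ĉ
R)`. -/
theorem norm_five_sub_sq_le {x y z u : ℕ → Ω → H} {A : H →L[ℝ] H} {T : ℕ}
    {ω : Ω} (h : ∀ t, 1 ≤ t → y t ω = A (x t ω) + u t ω) {lam : ℕ → ℝ} {f : ℕ → H}
    (hS : IsEigenSystem ((sampleCov x z T ω).adjoint ∘L sampleCov x z T ω) lam f) {α : ℝ}
    (hα : 0 < α) :
    ‖five x y z α T ω lam f - A ∘L projK f (rankK lam α)‖ ^ 2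
      ≤ ‖sampleCov u z T ω‖ ^ 2 * α⁻¹ := by
  have heq : five x y z α T ω lam f - A ∘L projK f (rankK lam α)
      = (sampleCov u z T ω).adjoint ∘L (sampleCov x z T ω ∘L regInv lam f (rankK lam α)) := by
    rw [five, sampleCov_adjoint_model h, ContinuousLinearMap.add_comp, ← hS.comp_regInv hα]
    simp only [ContinuousLinearMap.comp_assoc]
    abel
  rw [heq]
  calc _ ≤ (‖(sampleCov u z T ω).adjoint‖ * ‖sampleCov x z T ω ∘L regInv lam f (rankK lam α)‖) ^ 2 :=
        pow_le_pow_left₀ (norm_nonneg _) (ContinuousLinearMap.opNorm_comp_le _ _) 2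
    _ ≤ _ := by
        rw [mul_pow, LinearIsometryEquiv.norm_map]
        exact mul_le_mul_of_nonneg_left (norm_comp_regInv_sq_le hS hα) (sq_nonneg _)

end SampleCovariance

/-! ### Stochastic order calculus and exogeneity. -/

section Probability

variable {Ω : Type*} [mΩ : MeasurableSpace Ω] {μ : Measure Ω}

theorem IsBigOp.mono {X Y : ℕ → Ω → ℝ≥0∞} {a : ℕ → ℝ} (hY : IsBigOp μ Y a)
    (h : ∀ᶠ T in atTop, ∀ᵐ ω ∂μ, X T ω ≤ Y T ω) : IsBigOp μ X a := by
  intro ε hε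
  obtain ⟨M, hM⟩ := hY ε hε
  refine ⟨M, ?_⟩
  filter_upwards [hM, h] with T hT hle
  refine le_trans (measure_mono_ae ?_) hT
  filter_upwards [hle] with ω hω h'
  exact lt_of_lt_of_le h' hω

theorem IsBigOp.sq_mul {X : ℕ → Ω → ℝ≥0∞} {a b : ℕ → ℝ} (hX : IsBigOp μ X a)
    (ha : ∀ T, 0 ≤ a T) :
    IsBigOp μ (fun T ω => X T ω ^ 2 * ENNReal.ofReal (b T)) (fun T => a T ^ 2 * b T) := by
  intro ε hε
  obtain ⟨M, hM⟩ := hX ε hε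
  refine ⟨M ^ 2, hM.mono fun T hT => le_trans (measure_mono fun ω hω => ?_) hT⟩
  simp only [Set.mem_ofPred_eq] at hω ⊢
  by_contra! hle
  refine hω.not_ge ?_
  rw [ENNReal.ofReal_mul (sq_nonneg _), ENNReal.ofReal_pow (ha T), ENNReal.coe_pow, ← mul_assoc,
    ← mul_pow]
  gcongr

theorem IsBigOp.isLittleOp {X : ℕ → Ω → ℝ≥0∞} {a : ℕ → ℝ} (hX : IsBigOp μ X a)
    (ha : Tendsto a atTop (𝓝 0)) : IsLittleOp μ X := by
  intro η hη
  rw [ENNReal.tendsto_atTop_zero]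
  intro ε hε
  obtain ⟨M, hM⟩ := hX ε hε
  have hlim : Tendsto (fun T => (M : ℝ≥0∞) * ENNReal.ofReal (a T)) atTop (𝓝 0) := by
    have := ENNReal.Tendsto.const_mul (ENNReal.tendsto_ofReal ha)
      (Or.inr (ENNReal.coe_ne_top (r := M)))
    simpa using this
  -- The constant `M` depends on `ε` but not on `T`, so `M a_T` eventually drops below `η`.
  obtain ⟨N, hN⟩ := eventually_atTop.1 (hM.and (hlim.eventually (gt_mem_nhds hη)))
  exact ⟨N, fun T hT => (measure_mono fun ω (hω : η ≤ X T ω) =>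
    (hN T hT).2.trans_le hω).trans (hN T hT).1⟩

theorem IsLittleOp.mono {X Y : ℕ → Ω → ℝ≥0∞} (hY : IsLittleOp μ Y) (h : ∀ T ω, X T ω ≤ Y T ω) :
    IsLittleOp μ X := fun ε hε =>
  tendsto_of_tendsto_of_tendsto_of_le_of_le tendsto_const_nhds (hY ε hε) (fun _ => zero_le)
    fun T => measure_mono fun ω hω => le_trans hω (h T ω)

theorem IsLittleOp.sup {X Y : ℕ → Ω → ℝ≥0∞} (hX : IsLittleOp μ X) (hY : IsLittleOp μ Y) :
    IsLittleOp μ fun T ω => max (X T ω) (Y T ω) := fun ε hε => by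
  have h := (hX ε hε).add (hY ε hε)
  rw [add_zero] at h
  refine tendsto_of_tendsto_of_tendsto_of_le_of_le tendsto_const_nhds h (fun _ => zero_le)
    fun T => (measure_mono fun ω (hω : ε ≤ max _ _) => ?_).trans (measure_union_le _ _)
  exact le_max_iff.1 hω

theorem isLittleOp_of_tendstoInMeasure {Y : ℕ → Ω → ℝ}
    (hY : TendstoInMeasure μ Y atTop fun _ => 0) : IsLittleOp μ fun T ω => ‖Y T ω‖ₑ := by
  intro ε hε
  simpa [edist_zero_right] using hY ε hε

/-- A real sequence tends to zero in probability if it is eventually small wherever some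
`o_p(1)` sequence is small. -/
theorem tendstoInMeasure_of_isLittleOp {X : ℕ → Ω → ℝ≥0∞} (hX : IsLittleOp μ X) {Y : ℕ → Ω → ℝ}
    (h : ∀ δ : ℝ, 0 < δ → ∃ η : ℝ≥0∞, 0 < η ∧ ∀ᶠ T in atTop, ∀ ω, X T ω < η → |Y T ω| < δ) :
    TendstoInMeasure μ Y atTop (fun _ => 0) := by
  rw [tendstoInMeasure_iff_norm]
  intro δ hδ
  obtain ⟨η, hη, hev⟩ := h δ hδ
  refine tendsto_of_tendsto_of_tendsto_of_le_of_le' tendsto_const_nhds (hX η hη)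
    (Eventually.of_forall fun _ => zero_le) ?_
  filter_upwards [hev] with T hT
  refine measure_mono fun ω (hω : δ ≤ ‖Y T ω - 0‖) => ?_
  by_contra hcon
  rw [sub_zero, Real.norm_eq_abs] at hω
  exact (hT ω (not_le.1 hcon)).not_ge hω

variable {H : Type*} [NormedAddCommGroup H] [InnerProductSpace ℝ H]

/-- Exogeneity of the instrument makes the population covariance of error and instrument vanish. -/
theorem popCov_eq_zero [CompleteSpace H] [SecondCountableTopology H] [MeasurableSpace H]
    [BorelSpace H] [IsProbabilityMeasure μ] {u z : ℕ → Ω → H} (hu : MemLp (u 1) 2 μ)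
    (hz : MemLp (z 1) 2 μ) (hzm : ∀ t, 1 ≤ t → Measurable (z t))
    (hum : ∀ t, 1 ≤ t → Measurable (u t)) (hc : μ[u 1 | info z u 0] =ᵐ[μ] 0) :
    popCov μ u z = 0 := by
  -- A non-integrable integrand has Bochner integral zero by convention, which settles that case.
  by_cases hi : Integrable (fun ω => tensor (u 1 ω) (z 1 ω)) μ
  swap
  · rw [popCov, integral_undef hi]
  have hm : info z u 0 ≤ mΩ := by
    refine sup_le ?_ ?_
    · exact iSup₂_le fun s hs => (hzm s hs.1).comap_le
    · exact iSup₂_le fun s hs => (hum s hs.1).comap_le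
  -- The information at time `t` includes the instrument at time `t + 1`, so `z 1` is already known
  -- at time `0` and can be pulled out of the conditional expectation of `u 1`.
  have hzinfo : Measurable[info z u 0] (z 1) := by
    rw [measurable_iff_comap_le]
    exact le_sup_of_le_left (le_iSup₂_of_le 1 ⟨le_rfl, le_rfl⟩ le_rfl)
  ext ζ
  refine ext_inner_left ℝ fun η => ?_
  rw [popCov, ContinuousLinearMap.integral_apply hi, ← integral_inner
    (hi.apply_continuousLinearMap ζ), zero_apply, inner_zero_right]
  simp only [tensor_apply, inner_smul_right]
  have hci : μ[fun ω => inner ℝ ζ (u 1 ω) | info z u 0] =ᵐ[μ] 0 := by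
    have h1 := (innerSL ℝ ζ).comp_condExp_comm (m := info z u 0) (hu.integrable one_le_two)
    refine h1.symm.trans ?_
    filter_upwards [hc] with ω hω
    rw [Function.comp_apply, hω, Pi.zero_apply, map_zero]
    rfl
  have hg : StronglyMeasurable[info z u 0] fun ω => (inner ℝ η (z 1 ω) : ℝ) :=
    (measurable_const.inner hzinfo).stronglyMeasurable
  have hprod : Integrable (fun ω => inner ℝ ζ (u 1 ω) * inner ℝ η (z 1 ω)) μ :=
    (hu.const_inner ζ).integrable_mul (hz.const_inner η)
  have hpull := condExp_mul_of_stronglyMeasurable_right (μ := μ) hg hprod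
    ((hu.const_inner ζ).integrable one_le_two)
  have : ∫ ω, inner ℝ ζ (u 1 ω) * inner ℝ η (z 1 ω) ∂μ = 0 := by
    rw [← integral_condExp hm]
    refine integral_eq_zero_of_ae ?_
    refine hpull.trans ?_
    filter_upwards [hci] with ω hω
    rw [Pi.mul_apply, hω, Pi.zero_apply, zero_mul]
  simpa only [real_inner_comm ζ] using this

end Probability

end FIVE

/-! ### Assembly of the rate, the bias and consistency. -/

theorem theorem1
    {Ω : Type*} [MeasurableSpace Ω] (μ : Measure Ω) [IsProbabilityMeasure μ]
    {H : Type*} [NormedAddCommGroup H] [InnerProductSpace ℝ H] [CompleteSpace H]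
    [SecondCountableTopology H] [MeasurableSpace H] [BorelSpace H]
    (x y z u : ℕ → Ω → H) (A : H →L[ℝ] H)
    -- eigenelements of the population operator and of the sample operators
    (lam : ℕ → ℝ) (f : ℕ → H)
    (hpop : FIVE.IsEigenSystem ((FIVE.popCov μ x z).adjoint ∘L FIVE.popCov μ x z) lam f)
    (lamHat : ℕ → Ω → ℕ → ℝ) (fHat : ℕ → Ω → ℕ → H)
    (hsample : ∀ T ω, FIVE.IsEigenSystem
      ((FIVE.sampleCov x z T ω).adjoint ∘L FIVE.sampleCov x z T ω) (lamHat T ω) (fHat T ω))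
    (hA : FIVE.Assumption1 μ x y z u A lam)
    -- the regularization parameter
    (α : ℕ → ℝ) (hα_pos : ∀ T, 1 ≤ T → 0 < α T) (hα : Tendsto α atTop (𝓝 0))
    (hTα : Tendsto (fun T : ℕ => (T : ℝ)⁻¹ * (α T)⁻¹) atTop (𝓝 0))
    (hτ : TendstoInMeasure μ
      (fun (T : ℕ) ω => (T : ℝ) ^ (-(1 / 2) : ℝ) *
        FIVE.tauSum lam (FIVE.rankK (lamHat T ω) (α T))) atTop (fun _ => 0)) :
    FIVE.IsBigOp μ
      (fun T ω => ‖FIVE.five x y z (α T) T ω (lamHat T ω) (fHat T ω)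
        - A ∘L FIVE.projK (fHat T ω) (FIVE.rankK (lamHat T ω) (α T))‖ₑ ^ 2)
      (fun T => (T : ℝ)⁻¹ * (α T)⁻¹) ∧
    TendstoInMeasure μ
      (fun (T : ℕ) ω => ‖A ∘L (ContinuousLinearMap.id ℝ H
        - FIVE.projK (fHat T ω) (FIVE.rankK (lamHat T ω) (α T)))‖ ^ 2) atTop (fun _ => 0) ∧
    TendstoInMeasure μ
      (fun (T : ℕ) ω => ‖FIVE.five x y z (α T) T ω (lamHat T ω) (fHat T ω) - A‖) atTop
      (fun _ => 0) := by
  have hα_ev : ∀ᶠ T in atTop, 0 < α T := (eventually_ge_atTop 1).mono hα_pos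
  have hrate0 : Tendsto (fun T : ℕ => (T : ℝ) ^ (-(1 / 2) : ℝ)) atTop (𝓝 0) :=
    (tendsto_rpow_neg_atTop (by norm_num)).comp tendsto_natCast_atTop_atTop
  have huz : FIVE.popCov μ u z = 0 := FIVE.popCov_eq_zero (hA.memLp_u 1 le_rfl)
    (hA.memLp_z 1 le_rfl) hA.measurable_z hA.measurable_u (hA.condMean_u 1 le_rfl)
  -- Countably many times, so one null set serves them all.
  have hmodel : ∀ᵐ ω ∂μ, ∀ t, 1 ≤ t → y t ω = A (x t ω) + u t ω :=
    ae_all_iff.2 fun t => eventually_imp_distrib_left.2 (hA.model t)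
  have h1 : FIVE.IsBigOp μ
      (fun T ω => ‖FIVE.five x y z (α T) T ω (lamHat T ω) (fHat T ω)
        - A ∘L FIVE.projK (fHat T ω) (FIVE.rankK (lamHat T ω) (α T))‖ₑ ^ 2)
      (fun T => (T : ℝ)⁻¹ * (α T)⁻¹) := by
    have h := hA.rate_uz.sq_mul (b := fun T => (α T)⁻¹) fun T => by positivity
    have ha : (fun T : ℕ => ((T : ℝ) ^ (-(1 / 2) : ℝ)) ^ 2 * (α T)⁻¹)
        = fun T : ℕ => (T : ℝ)⁻¹ * (α T)⁻¹ := by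
      funext T
      rw [← Real.rpow_natCast, ← Real.rpow_mul (Nat.cast_nonneg T)]
      norm_num [Real.rpow_neg_one]
    rw [ha] at h
    refine h.mono ?_
    filter_upwards [hα_ev] with T hT
    filter_upwards [hmodel] with ω hω
    have hb := ENNReal.ofReal_le_ofReal (FIVE.norm_five_sub_sq_le hω (hsample T ω) hT)
    rw [ENNReal.ofReal_mul (sq_nonneg _), ENNReal.ofReal_pow (norm_nonneg _),
      ENNReal.ofReal_pow (norm_nonneg _), ofReal_norm, ofReal_norm] at hb
    refine hb.trans ?_
    gcongr
    rw [huz, sub_zero]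
    exact FIVE.enorm_le_hsNorm _
  have hC : FIVE.IsLittleOp μ fun T ω => ‖FIVE.sampleCov x z T ω - FIVE.popCov μ x z‖ₑ :=
    (hA.rate_xz.isLittleOp hrate0).mono fun T ω => FIVE.enorm_le_hsNorm _
  have h2 : TendstoInMeasure μ
      (fun (T : ℕ) ω => ‖A ∘L (ContinuousLinearMap.id ℝ H
        - FIVE.projK (fHat T ω) (FIVE.rankK (lamHat T ω) (α T)))‖) atTop (fun _ => 0) := by
    refine FIVE.tendstoInMeasure_of_isLittleOp hC fun δ hδ => ?_
    -- `B` depends on `δ` only and stays fixed as `T → ∞`, so its size is harmless. With `‖Ĉ - C‖`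
    -- and `√α` both below `δ / (4 (‖B‖ + 1))`, the second term of the bias bound is at most `δ /
    -- 2`; the `+ 1` covers `B = 0`.
    obtain ⟨B, hB⟩ := FIVE.exists_norm_sub_comp_lt hA.hilbertSchmidt hA.ker_eq_bot (half_pos hδ)
    have hη : 0 < δ / (4 * (‖B‖ + 1)) := by positivity
    refine ⟨ENNReal.ofReal (δ / (4 * (‖B‖ + 1))), ENNReal.ofReal_pos.2 hη, ?_⟩
    have hsq : Tendsto (fun T => √(α T)) atTop (𝓝 0) := by
      simpa using hα.sqrt
    filter_upwards [hα_ev, hsq.eventually (gt_mem_nhds hη)] with T hT hTη ω hω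
    rw [← ofReal_norm, ENNReal.ofReal_lt_ofReal_iff hη] at hω
    rw [abs_of_nonneg (norm_nonneg _)]
    have hb := FIVE.norm_comp_id_sub_projK_le_add (hsample T ω) hT A B (FIVE.popCov μ x z)
    have hBη : ‖B‖ * (2 * (δ / (4 * (‖B‖ + 1)))) ≤ δ / 2 := by
      rw [show ‖B‖ * (2 * (δ / (4 * (‖B‖ + 1)))) = δ / 2 * (‖B‖ / (‖B‖ + 1)) by
        field_simp; ring]
      refine mul_le_of_le_one_right (by positivity) ((div_le_one (by positivity)).2 (by linarith))
    have := mul_le_mul_of_nonneg_left (by linarith : ‖FIVE.sampleCov x z T ω - FIVE.popCov μ x z‖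
      + √(α T) ≤ 2 * (δ / (4 * (‖B‖ + 1)))) (norm_nonneg B)
    linarith
  have h1' := h1.isLittleOp hTα
  have h2' := FIVE.isLittleOp_of_tendstoInMeasure h2
  refine ⟨h1, FIVE.tendstoInMeasure_of_isLittleOp h2' fun δ hδ => ?_,
    FIVE.tendstoInMeasure_of_isLittleOp (h1'.sup h2') fun δ hδ => ?_⟩
  · refine ⟨ENNReal.ofReal √δ, ENNReal.ofReal_pos.2 (Real.sqrt_pos.2 hδ),
      Eventually.of_forall fun T ω hω => ?_⟩
    rw [enorm_norm, ← ofReal_norm, ENNReal.ofReal_lt_ofReal_iff (Real.sqrt_pos.2 hδ)] at hω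
    rw [abs_of_nonneg (sq_nonneg _), ← Real.sq_sqrt hδ.le]
    exact pow_lt_pow_left₀ hω (norm_nonneg _) two_ne_zero
  · have hδ2 := half_pos hδ
    -- The variance part is controlled through its squared norm and the bias part through its norm,
    -- hence the two thresholds, each yielding `δ / 2`.
    refine ⟨min (ENNReal.ofReal ((δ / 2) ^ 2)) (ENNReal.ofReal (δ / 2)),
      lt_min (ENNReal.ofReal_pos.2 (by positivity)) (ENNReal.ofReal_pos.2 hδ2),
      Eventually.of_forall fun T ω hω => ?_⟩
    have hω1 := (le_max_left _ _).trans_lt (hω.trans_le (min_le_left _ _))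
    have hω2 := (le_max_right _ _).trans_lt (hω.trans_le (min_le_right _ _))
    rw [← ofReal_norm, ← ENNReal.ofReal_pow (norm_nonneg _),
      ENNReal.ofReal_lt_ofReal_iff (by positivity)] at hω1
    rw [enorm_norm, ← ofReal_norm, ENNReal.ofReal_lt_ofReal_iff hδ2] at hω2
    have hω3 := lt_of_pow_lt_pow_left₀ 2 hδ2.le hω1
    rw [abs_of_nonneg (norm_nonneg _)]
    refine (norm_sub_le_norm_sub_add_norm_sub _
      (A ∘L FIVE.projK (fHat T ω) (FIVE.rankK (lamHat T ω) (α T))) _).trans_lt ?_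
    rw [ContinuousLinearMap.comp_sub, ContinuousLinearMap.comp_id, norm_sub_rev] at hω2
    linarith
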